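/- Let $b\ge 2$ be an integer, and let $a_0,\dots,a_{n-1}\in[0,1)^d$ be any points. Let $x_0,\dots,x_{n-1}$ be a scrambled version of these points in base $b$, obtained by one of the following two randomizations. Write $a_{ij}=\sum_{k\ge1}\xi_{ijk}b^{-k}$ for the base $b$ expansion of $a_{ij}$, the one that does not end in infinitely many digits $b-1$. (i) Owen's nested uniform scrambling: $x_{ij}=\sum_{k\ge1}\pi_{j;\xi_{ij1},\dots,\xi_{ij,k-1}}(\xi_{ijk})\,b^{-k}$, where the permutations $\pi_{j;w}$, indexed by the coordinates $j$ and all finite strings $w$ of base $b$ digits, are independent and uniformly distributed on the $b!$ permutations of $\{0,\dots,b-1\}$. (ii) Matoušek's affine linear scrambling, for $b$ a prime power: the digits are identified with the elements of a field $F$ with $b$ elements through a fixed bijection (for $b$ prime one may take $F=\mathbb{Z}/b\mathbb{Z}$), and the $k$-th digit of $x_{ij}$ is $\sum_{l=1}^{k}L_{j;k,l}\,\xi_{ijl}+c_{j;k}$, computed in $F$, where all the $L_{j;k,l}$ ($l\le k$) and $c_{j;k}$ are independent, each diagonal entry $L_{j;k,k}$ is uniformly distributed on $F\setminus\{0\}$,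 and the other $L_{j;k,l}$ and all $c_{j;k}$ are uniformly distributed on $F$. Let $f\in L^2[0,1)^d$ be real valued, let $j\in\{1,\dots,d\}$, and let $g$ be $f$ pre-integrated over $x_j$, that is, $g(x)=\int_0^1 f(x)\,\mathrm{d}x_j$, regarded as a function on $[0,1)^d$ that does not depend on $x_j$. Then $\frac1n\sum_{i=0}^{n-1}f(x_i)$ and $\frac1n\sum_{i=0}^{n-1}g(x_i)$ have finite second moments, and $$\operatorname{Var}\Bigl(\frac1n\sum_{i=0}^{n-1}g(x_i)\Bigr)\le\operatorname{Var}\Bigl(\frac1n\sum_{i=0}^{n-1}f(x_i)\Bigr).$$ -/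

import Mathlib

open MeasureTheory ProbabilityTheory

noncomputable section

/-- The half-open unit cube `[0,1)^d`. -/
def unitCube (d : ℕ) : Set (Fin d → ℝ) :=
  Set.univ.pi fun _ => Set.Ico (0 : ℝ) 1

/-- `f` pre-integrated over the coordinate `x_j`, kept as a function of all `d` coordinates. -/
def preIntegrate {d : ℕ} (j : Fin d) (f : (Fin d → ℝ) → ℝ) (x : Fin d → ℝ) : ℝ :=
  ∫ t in Set.Ico (0 : ℝ) 1, f (Function.update x j t)

/-- The sample average `(1/n) ∑_i f(x_i)`. -/
def sampleAverage {n d : ℕ} (f : (Fin d → ℝ) → ℝ) (x : Fin n → Fin d → ℝ) : ℝ :=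
  (1 / (n : ℝ)) * ∑ i, f (x i)

/-- The random variables `X i` are jointly independent, and each `X i` is uniformly distributed on
the set `s i`. It is used for finite types `α`, with the discrete σ-algebra. -/
def IndepUniform {Ω ι α : Type*} [MeasurableSpace Ω] (P : Measure Ω)
    (X : ι → Ω → α) (s : ι → Set α) : Prop :=
  letI : MeasurableSpace α := ⊤
  iIndepFun X P ∧ ∀ i, HasLaw (X i) (uniformOn (s i)) P

/-- Nested scrambling of one number `a ∈ [0,1)`: the base `b` digit of `a` that follows the
initial digit string `w` is replaced by its image under the permutation `π w`.
(`Real.digits a b k` is `⌊b^(k+1) a⌋ mod b`, so that the expansion of `a` is the one which does not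
end in infinitely many digits `b - 1`.) -/
def nestedScramble {b : ℕ} [NeZero b] (π : List (Fin b) → Equiv.Perm (Fin b)) (a : ℝ) : ℝ :=
  Real.ofDigits fun k =>
    π (List.ofFn fun m : Fin k => Real.digits a b m) (Real.digits a b k)

/-- Owen's nested uniform scrambling in base `b`: all the permutations, over all coordinates and
all digit strings, are independent and uniformly distributed on the permutations of the digits;
the same permutations are applied to all of the points `a i`. -/
def IsNestedUniformScrambling {Ω : Type*} [MeasurableSpace Ω] (P : Measure Ω)
    (b : ℕ) [NeZero b] {n d : ℕ} (a : Fin n → Fin d → ℝ) (x : Fin n → Ω → Fin d → ℝ) : Prop :=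
  ∃ π : Fin d × List (Fin b) → Ω → Equiv.Perm (Fin b),
    IndepUniform P π (fun _ => Set.univ) ∧
    ∀ᵐ ω ∂P, ∀ i j, x i ω j = nestedScramble (fun w => π (j, w) ω) (a i j)

/-- Affine linear scrambling of one number `a ∈ [0,1)`: the digits of `a` are read as elements of
`F` through `e`, multiplied by the infinite lower triangular matrix with the entries `L ⟨k, l⟩`,
`l ≤ k`, and shifted by `c`. -/
def affineScramble {b : ℕ} [NeZero b] {F : Type*} [Field F] (e : Fin b ≃ F)
    (L : (Σ k : ℕ, Fin (k + 1)) → F) (c : ℕ → F) (a : ℝ) : ℝ :=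
  Real.ofDigits fun k =>
    e.symm (∑ l : Fin (k + 1), L ⟨k, l⟩ * e (Real.digits a b l) + c k)

/-- The range of the random coefficients of an affine linear scrambling: diagonal matrix entries
are nonzero; entries below the diagonal (`Sum.inl`) and shifts (`Sum.inr`) are arbitrary. -/
def affineRange (F : Type*) [Field F] : (Σ k : ℕ, Fin (k + 1)) ⊕ ℕ → Set F
  | Sum.inl ⟨k, l⟩ => if l = Fin.last k then {0}ᶜ else Set.univ
  | Sum.inr _ => Set.univ

/-- Matoušek's affine linear scrambling in base `b`, with digit arithmetic in a field `F` of `b`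
elements (`ZMod b` for a prime `b`): all the coefficients, over all coordinates, are independent and
uniformly distributed on their ranges; they are the same for all of the points `a i`. -/
def IsAffineLinearScrambling {Ω : Type*} [MeasurableSpace Ω] (P : Measure Ω)
    (b : ℕ) [NeZero b] {n d : ℕ} (a : Fin n → Fin d → ℝ) (x : Fin n → Ω → Fin d → ℝ) : Prop :=
  ∃ (F : Type) (_ : Field F) (e : Fin b ≃ F)
    (C : Fin d × ((Σ k : ℕ, Fin (k + 1)) ⊕ ℕ) → Ω → F),
    IndepUniform P C (fun s => affineRange F s.2) ∧
    ∀ᵐ ω ∂P, ∀ i j, x i ω j =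
      affineScramble e (fun t => C (j, Sum.inl t) ω) (fun k => C (j, Sum.inr k) ω) (a i j)

end

/-!
The proof identifies pre-integration with a conditional expectation. Under either scrambling every
point `x i` is uniformly distributed on the unit cube, and the `j`-th coordinates of all the points
are independent of all their other coordinates. Let `m` be the σ-algebra generated by the
coordinates other than the `j`-th of all the points. Given `m`, the number `x i j` is still uniform
on `[0,1)`, so that `g (x i) = E[f (x i) | m]`, where `g` is `f` pre-integrated over the `j`-th
coordinate (`preIntegrate_ae_eq_condExp`). Summing over `i`, the sample average of `g` is the
conditional expectation of the sample average of `f`, whatever the dependence between the points,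
and the law of total variance gives the inequality (`variance_sampleAverage_preIntegrate_le`).

It remains to see that the scramblings have the two properties. Different coordinates use disjoint
blocks of the independent permutations or coefficients, which gives the independence
(`variance_sampleAverage_preIntegrate_le_of_blocks`). A number is uniform on `[0,1)` as soon as its
digits are independent and uniform (`measurePreserving_ofDigits`). The digits of a scrambled number
are so: in nested scrambling they are the values of different permutations
(`measurePreserving_nestedScramble`), and in affine scrambling they arise from an independent
sequence by adding the independent uniform shifts (`measurePreserving_affineScramble`).
-/

/-! ### Uniform measures on finite types -/

theorem eq_uniformOn_univ {α : Type*} [Finite α] [Nonempty α] [MeasurableSpace α]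
    [DiscreteMeasurableSpace α] (μ : Measure α) [IsProbabilityMeasure μ]
    (h : ∀ a a', μ {a} = μ {a'}) : μ = uniformOn Set.univ := by
  have := Fintype.ofFinite α
  refine Measure.ext_of_singleton fun a => ?_
  have h1 : (Fintype.card α : ENNReal) * μ {a} = 1 := by
    rw [← measure_univ (μ := μ), ← Finset.coe_univ, ← sum_measure_singleton,
      Finset.sum_congr rfl fun x _ => h x a]
    simp
  rw [uniformOn_univ, Measure.count_singleton, one_div]
  exact ENNReal.eq_inv_of_mul_eq_one_left (by rwa [mul_comm])

instance isProbabilityMeasure_uniformOn_univ {α : Type*} [Finite α] [Nonempty α]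
    [MeasurableSpace α] [DiscreteMeasurableSpace α] :
    IsProbabilityMeasure (uniformOn (Set.univ : Set α)) :=
  isProbabilityMeasure_uniformOn Set.finite_univ Set.univ_nonempty

theorem uniformOn_univ_singleton {α : Type*} [Fintype α] [MeasurableSpace α]
    [DiscreteMeasurableSpace α] (a : α) :
    uniformOn (Set.univ : Set α) {a} = (Fintype.card α : ENNReal)⁻¹ := by
  rw [uniformOn_univ, Measure.count_singleton, one_div]

theorem map_equiv_uniformOn_univ {α β : Type*} [Finite α] [Nonempty α] [MeasurableSpace α]
    [DiscreteMeasurableSpace α] [MeasurableSpace β] [DiscreteMeasurableSpace β] (e : α ≃ β) :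
    (uniformOn (Set.univ : Set α)).map e = uniformOn Set.univ := by
  have := Fintype.ofFinite α
  have := Finite.of_equiv _ e
  have : Nonempty β := e.nonempty_congr.1 inferInstance
  have : IsProbabilityMeasure ((uniformOn (Set.univ : Set α)).map e) :=
    Measure.isProbabilityMeasure_map Measurable.of_discrete.aemeasurable
  refine eq_uniformOn_univ _ fun y y' => ?_
  have h : ∀ y : β, e ⁻¹' {y} = {e.symm y} := fun y => by
    ext x; simp [Equiv.eq_symm_apply]
  simp only [Measure.map_apply Measurable.of_discrete (MeasurableSet.of_discrete), h,
    uniformOn_univ_singleton]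

/-- The image of a fixed point under a uniformly random permutation is uniformly distributed. -/
theorem map_perm_apply_uniformOn_univ {α : Type*} [Finite α] [Nonempty α] [MeasurableSpace α]
    [DiscreteMeasurableSpace α] [MeasurableSpace (Equiv.Perm α)]
    [DiscreteMeasurableSpace (Equiv.Perm α)] (a : α) :
    (uniformOn (Set.univ : Set (Equiv.Perm α))).map (fun p => p a) = uniformOn Set.univ := by
  classical
  have : IsProbabilityMeasure
      ((uniformOn (Set.univ : Set (Equiv.Perm α))).map (fun p => p a)) :=
    Measure.isProbabilityMeasure_map Measurable.of_discrete.aemeasurable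
  refine eq_uniformOn_univ _ fun y y' => ?_
  rw [Measure.map_apply .of_discrete .of_discrete, Measure.map_apply .of_discrete .of_discrete]
  -- left multiplication by a transposition carries `{p | p a = y'}` to `{p | p a = y}`
  conv_lhs => rw [← map_equiv_uniformOn_univ (Equiv.mulLeft (Equiv.swap y y'))]
  rw [Measure.map_apply .of_discrete .of_discrete]
  congr 1
  ext p
  simp [Equiv.swap_apply_eq_iff]

/-! ### Uniformly distributed digits give a uniformly distributed number -/

/-- The integer whose base `b` digits are the first `m` terms of `D`, the most significant first. -/
def prefixValue {b : ℕ} (D : ℕ → Fin b) : ℕ → ℕ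
  | 0 => 0
  | m + 1 => b * prefixValue D m + D m

theorem sum_ofDigitsTerm_eq_prefixValue {b : ℕ} [NeZero b] (D : ℕ → Fin b) (m : ℕ) :
    ∑ i ∈ Finset.range m, Real.ofDigitsTerm D i = prefixValue D m * ((b : ℝ) ^ m)⁻¹ := by
  have hb : (b : ℝ) ≠ 0 := Nat.cast_ne_zero.2 (NeZero.ne b)
  induction m with
  | zero => simp [prefixValue]
  | succ m ih =>
    rw [Finset.sum_range_succ, ih, Real.ofDigitsTerm, prefixValue]
    push_cast
    field_simp
    ring

theorem exists_prefixValue_eq_iff {b : ℕ} [NeZero b] (m p : ℕ) (hp : p < b ^ m) :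
    ∃ v : ℕ → Fin b, ∀ D : ℕ → Fin b, prefixValue D m = p ↔ ∀ i ∈ Finset.range m, D i = v i := by
  have hb : 0 < b := Nat.pos_of_ne_zero (NeZero.ne b)
  induction m generalizing p with
  | zero =>
    refine ⟨fun _ => 0, fun D => ?_⟩
    simp only [pow_zero, Nat.lt_one_iff] at hp
    simp [prefixValue, hp]
  | succ m ih =>
    obtain ⟨v, hv⟩ := ih (p / b) (by rw [Nat.div_lt_iff_lt_mul hb, ← pow_succ]; exact hp)
    refine ⟨Function.update v m ⟨p % b, Nat.mod_lt _ hb⟩, fun D => ?_⟩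
    have h1 : prefixValue D (m + 1) = p ↔ prefixValue D m = p / b ∧ (D m : ℕ) = p % b := by
      have := (D m).2
      rw [prefixValue, eq_comm (a := prefixValue D m), eq_comm (a := (D m : ℕ)),
        Nat.div_mod_unique hb]
      constructor
      · intro h; exact ⟨by lia, this⟩
      · rintro ⟨h, -⟩; lia
    rw [h1, hv, Finset.range_add_one, Finset.forall_mem_insert, and_comm, Function.update_self,
      Fin.ext_iff]
    refine and_congr Iff.rfl (forall₂_congr fun i hi => ?_)
    rw [Function.update_of_ne (Finset.mem_range.1 hi).ne]

theorem measurable_prefixValue {b : ℕ} (m : ℕ) :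
    Measurable fun D : ℕ → Fin b => prefixValue D m := by
  induction m with
  | zero => exact measurable_const
  | succ m ih =>
    have h : Measurable fun d : Fin b => (d : ℕ) := .of_discrete
    exact (ih.const_mul b).add (h.comp (measurable_pi_apply m))

/-- The law of a sequence of independent uniformly distributed elements of `α`. -/
noncomputable abbrev uniformSeq (α : Type*) [MeasurableSpace α] : Measure (ℕ → α) :=
  Measure.infinitePi fun _ => uniformOn Set.univ

theorem uniformSeq_prefixValue_eq {b : ℕ} [NeZero b] (m p : ℕ) (hp : p < b ^ m) :
    (uniformSeq (Fin b)).real {D | prefixValue D m = p} = ((b : ℝ) ^ m)⁻¹ := by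
  obtain ⟨v, hv⟩ := exists_prefixValue_eq_iff m p hp
  have h : {D : ℕ → Fin b | prefixValue D m = p} =
      Set.pi (Finset.range m : Set ℕ) fun i => {v i} := by
    ext D
    rw [Set.mem_ofPred_eq, hv]
    rfl
  rw [h, measureReal_def, Measure.infinitePi_pi _ fun _ _ => .of_discrete]
  simp [uniformOn_univ_singleton]

theorem uniformSeq_prefixValue_lt {b : ℕ} [NeZero b] (m K : ℕ) (hK : K ≤ b ^ m) :
    (uniformSeq (Fin b)).real {D | prefixValue D m < K} = K * ((b : ℝ) ^ m)⁻¹ := by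
  induction K with
  | zero => simp
  | succ K ih =>
    have h : {D : ℕ → Fin b | prefixValue D m < K + 1} =
        {D | prefixValue D m < K} ∪ {D | prefixValue D m = K} := by
      ext D
      simp only [Set.mem_ofPred_eq, Set.mem_union]
      lia
    rw [h, measureReal_union, ih (by lia), uniformSeq_prefixValue_eq m K (by lia)]
    · push_cast; ring
    · rw [Set.disjoint_left]
      intro D h1 h2
      simp only [Set.mem_ofPred_eq] at h1 h2
      lia
    · exact measurable_prefixValue m (measurableSet_singleton K)

theorem measurable_ofDigits {b : ℕ} : Measurable (@Real.ofDigits b) :=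
  Real.continuous_ofDigits.measurable

/-- The distribution function of a number with uniform digits is the identity on `[0,1)`: the
first `m` digits determine it up to an error of `b⁻ᵐ`. -/
theorem uniformSeq_ofDigits_le {b : ℕ} [NeZero b] (hb : 2 ≤ b) {t : ℝ} (ht : t ∈ Set.Ico (0 : ℝ) 1) :
    (uniformSeq (Fin b)).real {D | Real.ofDigits D ≤ t} = t := by
  have hbr : (1 : ℝ) < b := by exact_mod_cast hb
  have key : ∀ m : ℕ,
      |(uniformSeq (Fin b)).real {D | Real.ofDigits D ≤ t} - t| ≤ ((b : ℝ)⁻¹) ^ m := by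
    intro m
    have hpos : (0 : ℝ) < (b : ℝ) ^ m := by positivity
    have hfl := Nat.floor_le (mul_nonneg hpos.le ht.1)
    have hlt := Nat.lt_floor_add_one ((b : ℝ) ^ m * t)
    set K := ⌊(b : ℝ) ^ m * t⌋₊ with hKdef
    have hK : K + 1 ≤ b ^ m := by
      have : (K : ℝ) < (b : ℝ) ^ m := by nlinarith [ht.2]
      exact_mod_cast this
    have hX : ∀ D : ℕ → Fin b, (prefixValue D m : ℝ) ≤ (b : ℝ) ^ m * Real.ofDigits D ∧
        (b : ℝ) ^ m * Real.ofDigits D ≤ prefixValue D m + 1 := by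
      intro D
      have h0 := Real.ofDigits_nonneg fun i => D (i + m)
      have h1 := Real.ofDigits_le_one fun i => D (i + m)
      have h2 : (b : ℝ) ^ m * Real.ofDigits D =
          prefixValue D m + Real.ofDigits fun i => D (i + m) := by
        rw [Real.ofDigits_eq_sum_add_ofDigits D m, sum_ofDigitsTerm_eq_prefixValue]
        field_simp
      constructor <;> linarith
    have hlow : (K : ℝ) * ((b : ℝ) ^ m)⁻¹ ≤
        (uniformSeq (Fin b)).real {D | Real.ofDigits D ≤ t} := by
      rw [← uniformSeq_prefixValue_lt m K (by lia)]
      refine measureReal_mono fun D hD => ?_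
      have hD' : (prefixValue D m : ℝ) + 1 ≤ K := by exact_mod_cast hD
      exact le_of_mul_le_mul_left (((hX D).2.trans hD').trans hfl) hpos
    have hup : (uniformSeq (Fin b)).real {D | Real.ofDigits D ≤ t} ≤
        ((K + 1 : ℕ) : ℝ) * ((b : ℝ) ^ m)⁻¹ := by
      rw [← uniformSeq_prefixValue_lt m (K + 1) hK]
      refine measureReal_mono fun D hD => ?_
      have hD' : Real.ofDigits D ≤ t := hD
      exact Nat.lt_succ_of_le
        (Nat.le_floor ((hX D).1.trans (mul_le_mul_of_nonneg_left hD' hpos.le)))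
    push_cast at hup
    rw [inv_pow, abs_le]
    have e1 : (K : ℝ) * ((b : ℝ) ^ m)⁻¹ ≤ t := by
      rw [← div_eq_mul_inv, div_le_iff₀' hpos]; exact hfl
    have e2 : t ≤ ((K : ℝ) + 1) * ((b : ℝ) ^ m)⁻¹ := by
      rw [← div_eq_mul_inv, le_div_iff₀' hpos]; exact hlt.le
    constructor <;> linarith
  have hlim := tendsto_pow_atTop_nhds_zero_of_lt_one (r := (b : ℝ)⁻¹) (by positivity)
    (inv_lt_one_of_one_lt₀ hbr)
  exact sub_eq_zero.1 (abs_nonpos_iff.1 (ge_of_tendsto' hlim key))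

instance isProbabilityMeasure_restrict_Ico :
    IsProbabilityMeasure (volume.restrict (Set.Ico (0 : ℝ) 1)) :=
  ⟨by simp⟩

theorem measurePreserving_ofDigits {b : ℕ} [NeZero b] (hb : 2 ≤ b) :
    MeasurePreserving (@Real.ofDigits b) (uniformSeq (Fin b))
      (volume.restrict (Set.Ico (0 : ℝ) 1)) := by
  refine ⟨measurable_ofDigits, ?_⟩
  have : IsProbabilityMeasure ((uniformSeq (Fin b)).map (@Real.ofDigits b)) :=
    Measure.isProbabilityMeasure_map measurable_ofDigits.aemeasurable
  refine Measure.ext_of_Iic _ _ fun t => ?_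
  rw [Measure.map_apply measurable_ofDigits measurableSet_Iic,
    Measure.restrict_apply measurableSet_Iic]
  rcases lt_or_ge t 0 with h | h
  · have e1 : Real.ofDigits ⁻¹' Set.Iic t = (∅ : Set (ℕ → Fin b)) := by
      ext D
      simpa using h.trans_le (Real.ofDigits_nonneg D)
    have e2 : Set.Iic t ∩ Set.Ico 0 1 = ∅ := by
      ext s
      simp only [Set.mem_inter_iff, Set.mem_Iic, Set.mem_Ico, Set.mem_empty_iff_false, iff_false]
      intro hs
      linarith [hs.1, hs.2.1]
    rw [e1, e2, measure_empty, measure_empty]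
  rcases lt_or_ge t 1 with h' | h'
  · have e1 := uniformSeq_ofDigits_le hb ⟨h, h'⟩
    have e2 : Set.Iic t ∩ Set.Ico 0 1 = Set.Icc 0 t := by
      ext s
      simp only [Set.mem_inter_iff, Set.mem_Iic, Set.mem_Ico, Set.mem_Icc]
      constructor
      · intro hs; exact ⟨hs.2.1, hs.1⟩
      · intro hs; exact ⟨hs.2, hs.1, hs.2.trans_lt h'⟩
    rw [e2, Real.volume_Icc, sub_zero, ← ofReal_measureReal]
    exact congrArg ENNReal.ofReal e1
  · have e1 : Real.ofDigits ⁻¹' Set.Iic t = (Set.univ : Set (ℕ → Fin b)) := by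
      ext D
      simpa using (Real.ofDigits_le_one D).trans h'
    have e2 : Set.Iic t ∩ Set.Ico 0 1 = Set.Ico 0 1 :=
      Set.inter_eq_right.2 fun s hs => (hs.2.le.trans h' : s ≤ t)
    rw [e1, e2]
    simp

/-! ### The law of one scrambled number -/

/-- Distinct digit positions use permutations indexed by strings of distinct lengths, so the
scrambled digits are independent. -/
theorem measurePreserving_nestedScramble {b : ℕ} [NeZero b] (hb : 2 ≤ b)
    [MeasurableSpace (Equiv.Perm (Fin b))] [DiscreteMeasurableSpace (Equiv.Perm (Fin b))] (a : ℝ) :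
    MeasurePreserving (fun π : List (Fin b) → Equiv.Perm (Fin b) => nestedScramble π a)
      (Measure.infinitePi fun _ => uniformOn Set.univ)
      (volume.restrict (Set.Ico (0 : ℝ) 1)) := by
  have hm : ∀ k : ℕ, Measurable fun p : Equiv.Perm (Fin b) => p (Real.digits a b k) :=
    fun k => .of_discrete
  let w : ℕ → List (Fin b) := fun k => List.ofFn fun m : Fin k => Real.digits a b m
  have hw : Function.Injective w := fun k l h => by
    simpa [w] using congrArg List.length h
  let ρ : Measure (List (Fin b) → Equiv.Perm (Fin b)) :=
    Measure.infinitePi fun _ => uniformOn Set.univ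
  have hind : iIndepFun (fun k (π : List (Fin b) → Equiv.Perm (Fin b)) =>
      π (w k) (Real.digits a b k)) ρ :=
    ((iIndepFun_infinitePi (P := fun _ : List (Fin b) =>
        uniformOn (Set.univ : Set (Equiv.Perm (Fin b)))) (X := fun _ => id)
        fun _ => measurable_id).precomp hw).comp
      (fun k p => p (Real.digits a b k)) hm
  have hlaw : ∀ k, HasLaw (fun π : List (Fin b) → Equiv.Perm (Fin b) =>
      π (w k) (Real.digits a b k)) (uniformOn Set.univ) ρ := fun k =>
    ((⟨hm k, map_perm_apply_uniformOn_univ _⟩ : MeasurePreserving _ _ _).comp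
      (measurePreserving_eval_infinitePi _ (w k))).hasLaw
  have hmeas : Measurable fun (π : List (Fin b) → Equiv.Perm (Fin b)) k =>
      π (w k) (Real.digits a b k) :=
    measurable_pi_lambda _ fun k => (hm k).comp (measurable_pi_apply _)
  exact (measurePreserving_ofDigits hb).comp
    ((hind.hasLaw_infinitePi hlaw hmeas.aemeasurable).measurePreserving hmeas)

theorem comap_pi_le_iSup_range {Ω ι κ α : Type*} [MeasurableSpace α] (X : ι → Ω → α) (u : κ → ι) :
    MeasurableSpace.comap (fun ω i => X (u i) ω) MeasurableSpace.pi ≤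
      ⨆ i ∈ Set.range u, MeasurableSpace.comap (X i) inferInstance := by
  rw [← measurable_iff_comap_le]
  refine @measurable_pi_lambda _ _ _ (_) _ _ fun i => ?_
  rw [measurable_iff_comap_le]
  exact le_iSup₂_of_le (u i) ⟨i, rfl⟩ le_rfl

/-- Disjoint subfamilies of an independent family are independent. -/
theorem indepFun_of_disjoint_range {Ω ι κ₁ κ₂ α : Type*} [MeasurableSpace Ω] [MeasurableSpace α]
    {P : Measure Ω} {X : ι → Ω → α} (hX : iIndepFun X P) (hm : ∀ i, Measurable (X i))
    {u : κ₁ → ι} {v : κ₂ → ι} (huv : ∀ i j, u i ≠ v j) :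
    IndepFun (fun ω i => X (u i) ω) (fun ω j => X (v j) ω) P := by
  have hdisj : Disjoint (Set.range u) (Set.range v) := by
    rw [Set.disjoint_left]
    rintro _ ⟨i, rfl⟩ ⟨j, hj⟩
    exact huv i j hj.symm
  exact indep_of_indep_of_le_left (indep_of_indep_of_le_right
    (indep_iSup_of_disjoint (fun i => (hm i).comap_le) hX hdisj) (comap_pi_le_iSup_range X v)) (comap_pi_le_iSup_range X u)

/-- The shifts are independent of the matrix and uniform on `F`, so that the shifted digits are
independent and uniform whatever the law of the matrix is. -/
theorem measurePreserving_affineScramble {b : ℕ} [NeZero b] (hb : 2 ≤ b) {F : Type*} [Field F]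
    [MeasurableSpace F] [DiscreteMeasurableSpace F] (e : Fin b ≃ F)
    (ν : (Σ k : ℕ, Fin (k + 1)) ⊕ ℕ → Measure F) [∀ s, IsProbabilityMeasure (ν s)]
    (hν : ∀ k, ν (Sum.inr k) = uniformOn Set.univ) (a : ℝ) :
    MeasurePreserving (fun C : (Σ k : ℕ, Fin (k + 1)) ⊕ ℕ → F =>
      affineScramble e (fun t => C (Sum.inl t)) (fun k => C (Sum.inr k)) a)
      (Measure.infinitePi ν) (volume.restrict (Set.Ico (0 : ℝ) 1)) := by
  have := Finite.of_equiv _ e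
  have : MeasurableAdd₂ F := ⟨.of_discrete⟩
  have : MeasurableMul F := ⟨fun _ => .of_discrete, fun _ => .of_discrete⟩
  let S : ((Σ k : ℕ, Fin (k + 1)) → F) → ℕ → F := fun L k =>
    ∑ l : Fin (k + 1), L ⟨k, l⟩ * e (Real.digits a b l)
  have hS : Measurable S := measurable_pi_lambda _ fun k =>
    Finset.measurable_sum _ fun l _ => (measurable_pi_apply _).mul_const _
  have hind : iIndepFun (fun s (C : (Σ k : ℕ, Fin (k + 1)) ⊕ ℕ → F) => C s)
      (Measure.infinitePi ν) := iIndepFun_infinitePi (X := fun _ => id) fun _ => measurable_id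
  have hm1 : Measurable fun (C : (Σ k : ℕ, Fin (k + 1)) ⊕ ℕ → F) t => C (Sum.inl t) := by fun_prop
  have hm2 : Measurable fun (C : (Σ k : ℕ, Fin (k + 1)) ⊕ ℕ → F) k => C (Sum.inr k) := by fun_prop
  have hc : (Measure.infinitePi ν).map (fun C k => C (Sum.inr k)) = uniformSeq F := by
    have h := (hind.precomp Sum.inr_injective).hasLaw_infinitePi
      (fun k => (measurePreserving_eval_infinitePi ν (Sum.inr k)).hasLaw) hm2.aemeasurable
    rw [h.map_eq]
    simp_rw [hν]
  have hpair := (indepFun_iff_map_prod_eq_prod_map_map hm1.aemeasurable hm2.aemeasurable).1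
    (indepFun_of_disjoint_range hind (fun s => measurable_pi_apply s)
      (u := Sum.inl) (v := Sum.inr) fun _ _ => Sum.inl_ne_inr)
  rw [hc] at hpair
  have : IsProbabilityMeasure ((Measure.infinitePi ν).map (fun C t => C (Sum.inl t))) :=
    Measure.isProbabilityMeasure_map hm1.aemeasurable
  have hadd : Measurable fun p : ((Σ k : ℕ, Fin (k + 1)) → F) × (ℕ → F) => S p.1 + p.2 :=
    (hS.comp measurable_fst).add measurable_snd
  have hshift := (MeasurePreserving.id ((Measure.infinitePi ν).map
    (fun C t => C (Sum.inl t)))).skew_product (μc := uniformSeq F) (μd := uniformSeq F)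
    (g := fun L c => S L + c) hadd (.of_forall fun L => by
      change (uniformSeq F).map (fun c k => S L k + c k) = _
      rw [Measure.infinitePi_map_pi _ fun _ => .of_discrete]
      congr 1
      funext k
      exact map_equiv_uniformOn_univ (Equiv.addLeft (S L k)))
  have hdigits : MeasurePreserving (fun (c : ℕ → F) k => e.symm (c k)) (uniformSeq F)
      (uniformSeq (Fin b)) := by
    refine ⟨measurable_pi_lambda _ fun k => Measurable.of_discrete.comp (measurable_pi_apply k), ?_⟩
    rw [Measure.infinitePi_map_pi _ fun _ => .of_discrete]
    simp_rw [map_equiv_uniformOn_univ]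
  exact (measurePreserving_ofDigits hb).comp (hdigits.comp (measurePreserving_snd.comp
    (hshift.comp ⟨hm1.prodMk hm2, hpair⟩)))

/-! ### Pre-integration as a conditional expectation -/

theorem pi_restrict_Ico_eq (d : ℕ) :
    Measure.pi (fun _ : Fin d => volume.restrict (Set.Ico (0 : ℝ) 1)) =
      volume.restrict (unitCube d) := by
  rw [unitCube, volume_pi, Measure.restrict_pi_pi]

section

variable {Ω : Type*} [mΩ : MeasurableSpace Ω] {P : Measure Ω} [IsProbabilityMeasure P]

theorem hasLaw_unitCube {d : ℕ} {U : Fin d → Ω → ℝ} (hind : iIndepFun U P)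
    (hlaw : ∀ k, HasLaw (U k) (volume.restrict (Set.Ico (0 : ℝ) 1)) P) :
    HasLaw (fun ω k => U k ω) (volume.restrict (unitCube d)) P := by
  refine ⟨aemeasurable_pi_lambda _ fun k => (hlaw k).aemeasurable, ?_⟩
  rw [(iIndepFun_iff_map_fun_eq_pi_map fun k => (hlaw k).aemeasurable).1 hind,
    ← pi_restrict_Ico_eq]
  simp_rw [fun k => (hlaw k).map_eq]

/-- Averaging `f` at a uniformly distributed point over the `j`-th coordinate alone, given a random
element `Z` that determines the other coordinates and is independent of the `j`-th one. -/
theorem preIntegrate_ae_eq_condExp {d : ℕ} {β : Type*} [MeasurableSpace β] {U : Ω → Fin d → ℝ}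
    (hU : HasLaw U (volume.restrict (unitCube d)) P) {f : (Fin d → ℝ) → ℝ}
    (hf : MemLp f 2 (volume.restrict (unitCube d))) (j : Fin d)
    (hUj : HasLaw (fun ω => U ω j) (volume.restrict (Set.Ico (0 : ℝ) 1)) P)
    {Z : Ω → β} (hZ : Measurable Z) (hind : IndepFun Z (fun ω => U ω j) P)
    {r : β → Fin d → ℝ} (hr : Measurable r) (hrZ : ∀ ω, ∀ k ≠ j, r (Z ω) k = U ω k) :
    (fun ω => preIntegrate j f (U ω)) =ᵐ[P]
      P[fun ω => f (U ω) | MeasurableSpace.comap Z inferInstance] := by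
  have hfU : Integrable (fun ω => f (U ω)) P := by
    have h : MemLp f 2 (P.map U) := by rw [hU.map_eq]; exact hf
    exact (h.comp_of_map hU.aemeasurable).integrable one_le_two
  have hupd : ∀ ω t, Function.update (r (Z ω)) j t = Function.update (U ω) j t := by
    intro ω t
    funext k
    by_cases hk : k = j
    · subst hk; simp
    · simp [hk, hrZ ω k hk]
  have hm : Measurable fun p : β × ℝ => Function.update (r p.1) j p.2 := by
    refine measurable_pi_lambda _ fun k => ?_
    by_cases hk : k = j
    · subst hk; simpa using measurable_snd
    · simpa [hk, Function.comp_def] using (measurable_pi_apply k).comp (hr.comp measurable_fst)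
  have hprod := (indepFun_iff_map_prod_eq_prod_map_map hZ.aemeasurable hUj.aemeasurable).1 hind
  have hfm : AEStronglyMeasurable (fun p : β × ℝ => f (Function.update (r p.1) j p.2))
      (P.map fun ω => (Z ω, U ω j)) := by
    refine AEStronglyMeasurable.comp_measurable (g := f) ?_ hm
    rw [AEMeasurable.map_map_of_aemeasurable hm.aemeasurable
      (hZ.aemeasurable.prodMk hUj.aemeasurable)]
    have h : (fun p : β × ℝ => Function.update (r p.1) j p.2) ∘ (fun ω => (Z ω, U ω j)) = U := by
      funext ω
      simp [hupd]
    rw [h, hU.map_eq]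
    exact hf.1
  have hcond := condExp_prod_ae_eq_integral_condDistrib₀ hZ hUj.aemeasurable hfm
    (by simpa [hupd] using hfU)
  simp only [hupd, Function.update_eq_self] at hcond
  have hker := ae_of_ae_map hZ.aemeasurable (condDistrib_ae_eq_of_measure_eq_compProd Z
    hUj.aemeasurable (κ := Kernel.const β (P.map fun ω => U ω j))
    (by rw [hprod, Measure.compProd_const]))
  filter_upwards [hcond, hker] with ω h1 h2
  rw [h1, h2, Kernel.const_apply, hUj.map_eq, preIntegrate]

/-- Here `Y k ω i` is the `k`-th coordinate of the `i`-th point. The σ-algebra `m` is generated by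
`Y k` for all `k ≠ j`, and does not depend on `i`; this is why arbitrary dependence between the
points is harmless. -/
theorem sampleAverage_preIntegrate_ae_eq_condExp {n d : ℕ} {Y : Fin d → Ω → Fin n → ℝ}
    (hY : ∀ k, Measurable (Y k)) (hind : iIndepFun Y P)
    (hlaw : ∀ k i, HasLaw (fun ω => Y k ω i) (volume.restrict (Set.Ico (0 : ℝ) 1)) P)
    {f : (Fin d → ℝ) → ℝ} (hf : MemLp f 2 (volume.restrict (unitCube d))) (j : Fin d) :
    MemLp (fun ω => sampleAverage f fun i k => Y k ω i) 2 P ∧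
    ∃ m ≤ mΩ, (fun ω => sampleAverage (preIntegrate j f) fun i k => Y k ω i) =ᵐ[P]
      P[fun ω => sampleAverage f fun i k => Y k ω i | m] := by
  have hcube : ∀ i, HasLaw (fun ω k => Y k ω i) (volume.restrict (unitCube d)) P := fun i =>
    hasLaw_unitCube (hind.comp (fun _ y => y i) fun _ => measurable_pi_apply i) fun k => hlaw k i
  have hL2 : ∀ i, MemLp (fun ω => f fun k => Y k ω i) 2 P := fun i => by
    have h : MemLp f 2 (P.map fun ω k => Y k ω i) := by rw [(hcube i).map_eq]; exact hf
    exact h.comp_of_map (hcube i).aemeasurable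
  refine ⟨(memLp_finsetSum _ fun i _ => hL2 i).const_mul _, ?_⟩
  let Z : Ω → {k // k ≠ j} → Fin n → ℝ := fun ω k => Y k ω
  have hZ : Measurable Z := measurable_pi_lambda _ fun k => hY k
  have hZj : IndepFun Z (fun ω (_ : Unit) => Y j ω) P :=
    indepFun_of_disjoint_range hind hY (u := fun k : {k // k ≠ j} => (k : Fin d)) (v := fun _ => j)
      fun k _ => k.2
  refine ⟨MeasurableSpace.comap Z inferInstance, hZ.comap_le, ?_⟩
  have hpt : ∀ i, (fun ω => preIntegrate j f fun k => Y k ω i) =ᵐ[P]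
      P[fun ω => f fun k => Y k ω i | MeasurableSpace.comap Z inferInstance] := fun i => by
    refine preIntegrate_ae_eq_condExp (hcube i) hf j (hlaw j i) hZ
      (hZj.comp measurable_id ((measurable_pi_apply i).comp (measurable_pi_apply ())))
      (r := fun z k => if hk : k ≠ j then z ⟨k, hk⟩ i else 0) ?_ ?_
    · refine measurable_pi_lambda _ fun k => ?_
      by_cases hk : k ≠ j
      · simpa only [dif_pos hk, Function.comp_def] using (measurable_pi_apply i).comp (measurable_pi_apply _)
      · simpa only [dif_neg hk] using measurable_const
    · intro ω k hk
      simp [hk, Z]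
  have hsum := condExp_finsetSum (μ := P) (s := Finset.univ)
    (f := fun i ω => f fun k => Y k ω i) (fun i _ => (hL2 i).integrable one_le_two)
    (MeasurableSpace.comap Z inferInstance)
  have hsmul := condExp_smul (μ := P) (1 / (n : ℝ)) (∑ i, fun ω => f fun k => Y k ω i)
    (MeasurableSpace.comap Z inferInstance)
  have heq : (fun ω => sampleAverage f fun i k => Y k ω i) =
      (1 / (n : ℝ)) • ∑ i, fun ω => f fun k => Y k ω i := by
    funext ω
    simp [sampleAverage]
  rw [heq]
  filter_upwards [hsum, hsmul, ae_all_iff.2 hpt] with ω h1 h2 h3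
  rw [h2, Pi.smul_apply, h1, Finset.sum_apply, sampleAverage, smul_eq_mul]
  simp only [h3]

theorem variance_sampleAverage_preIntegrate_le {n d : ℕ} {Y : Fin d → Ω → Fin n → ℝ}
    (hY : ∀ k, Measurable (Y k)) (hind : iIndepFun Y P)
    (hlaw : ∀ k i, HasLaw (fun ω => Y k ω i) (volume.restrict (Set.Ico (0 : ℝ) 1)) P)
    {x : Fin n → Ω → Fin d → ℝ} (hx : ∀ᵐ ω ∂P, ∀ i k, x i ω k = Y k ω i)
    {f : (Fin d → ℝ) → ℝ} (hf : MemLp f 2 (volume.restrict (unitCube d))) (j : Fin d) :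
    MemLp (fun ω => sampleAverage f fun i => x i ω) 2 P ∧
    MemLp (fun ω => sampleAverage (preIntegrate j f) fun i => x i ω) 2 P ∧
    variance (fun ω => sampleAverage (preIntegrate j f) fun i => x i ω) P ≤
      variance (fun ω => sampleAverage f fun i => x i ω) P := by
  obtain ⟨hL2, m, hm, hcond⟩ := sampleAverage_preIntegrate_ae_eq_condExp hY hind hlaw hf j
  have hxY : ∀ h : (Fin d → ℝ) → ℝ, (fun ω => sampleAverage h fun i k => Y k ω i) =ᵐ[P]
      fun ω => sampleAverage h fun i => x i ω := fun h => by
    filter_upwards [hx] with ω hω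
    congr 1
    funext i k
    exact (hω i k).symm
  have hg := (hxY (preIntegrate j f)).symm.trans hcond
  refine ⟨hL2.ae_eq (hxY f), (hL2.condExp one_le_two).ae_eq hg.symm, ?_⟩
  rw [variance_congr hg, ← variance_congr (hxY f), ← integral_condVar_add_variance_condExp hm hL2]
  refine le_add_of_nonneg_left (integral_nonneg_of_ae ?_)
  exact condExp_nonneg (.of_forall fun ω => sq_nonneg _)

/-! ### Scramblings driven by independent coordinate blocks -/

/-- If the randomness `C (k, ·)` of the coordinates `k` consists of independent variables with laws
`ν`, and each coordinate of each point is a function of the block of its coordinate that turns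
`ν` into the uniform law, then pre-integration does not increase the variance. -/
theorem variance_sampleAverage_preIntegrate_le_of_blocks {ι α : Type*} [Countable ι]
    [MeasurableSpace α] {n d : ℕ} {ν : ι → Measure α} [∀ t, IsProbabilityMeasure (ν t)]
    {C : Fin d × ι → Ω → α} (hC : iIndepFun C P) (hlaw : ∀ p, HasLaw (C p) (ν p.2) P)
    {Φ : Fin n → Fin d → (ι → α) → ℝ}
    (hΦ : ∀ i k, MeasurePreserving (Φ i k) (Measure.infinitePi ν)
      (volume.restrict (Set.Ico (0 : ℝ) 1)))
    {x : Fin n → Ω → Fin d → ℝ} (hx : ∀ᵐ ω ∂P, ∀ i k, x i ω k = Φ i k fun t => C (k, t) ω)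
    {f : (Fin d → ℝ) → ℝ} (hf : MemLp f 2 (volume.restrict (unitCube d))) (j : Fin d) :
    MemLp (fun ω => sampleAverage f fun i => x i ω) 2 P ∧
    MemLp (fun ω => sampleAverage (preIntegrate j f) fun i => x i ω) 2 P ∧
    variance (fun ω => sampleAverage (preIntegrate j f) fun i => x i ω) P ≤
      variance (fun ω => sampleAverage f fun i => x i ω) P := by
  -- everywhere measurable versions of the countably many variables `C p`
  let C' : Fin d × ι → Ω → α := fun p => (hlaw p).aemeasurable.mk (C p)
  have hC'm : ∀ p, Measurable (C' p) := fun p => (hlaw p).aemeasurable.measurable_mk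
  have hCC' : ∀ p, C p =ᵐ[P] C' p := fun p => (hlaw p).aemeasurable.ae_eq_mk
  have hC' : iIndepFun C' P := hC.congr hCC'
  have hlaw' : ∀ p, HasLaw (C' p) (ν p.2) P := fun p => (hlaw p).congr (hCC' p).symm
  let B : Fin d → Ω → ι → α := fun k ω t => C' (k, t) ω
  have hB : ∀ k, Measurable (B k) := fun k => measurable_pi_lambda _ fun t => hC'm _
  have hBlaw : ∀ k, HasLaw (B k) (Measure.infinitePi ν) P := fun k =>
    (hC'.precomp (g := fun t => (k, t)) (Prod.mk_right_injective k)).hasLaw_infinitePi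
      (fun t => hlaw' (k, t)) (hB k).aemeasurable
  have hBind : iIndepFun B P := by
    have hall := hC'.hasLaw_infinitePi hlaw' (measurable_pi_lambda _ hC'm).aemeasurable
    refine (iIndepFun_iff_hasLaw_Pi_infinitePi hBlaw
      (measurable_pi_lambda _ hB).aemeasurable).2 ?_
    exact (⟨(MeasurableEquiv.curry (Fin d) ι α).measurable, Measure.infinitePi_map_curry
      fun (_ : Fin d) => ν⟩ : MeasurePreserving _ _ _).fun_comp_hasLaw hall
  have hG : ∀ k, Measurable fun (c : ι → α) i => Φ i k c := fun k =>
    measurable_pi_lambda _ fun i => (hΦ i k).measurable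
  refine variance_sampleAverage_preIntegrate_le (Y := fun k ω i => Φ i k (B k ω))
    (fun k => (hG k).comp (hB k)) (hBind.comp _ hG)
    (fun k i => (hΦ i k).fun_comp_hasLaw (hBlaw k)) ?_ hf j
  filter_upwards [hx, ae_all_iff.2 hCC'] with ω h1 h2 i k
  rw [h1]
  simp only [h2, B]

end

theorem theorem1 {Ω : Type*} [MeasurableSpace Ω] (P : Measure Ω) [IsProbabilityMeasure P]
    (b : ℕ) [NeZero b] (hb : 2 ≤ b) (n d : ℕ)
    (a : Fin n → Fin d → ℝ) (ha : ∀ i, a i ∈ unitCube d)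
    (x : Fin n → Ω → Fin d → ℝ)
    (hx : IsNestedUniformScrambling P b a x ∨ IsAffineLinearScrambling P b a x)
    (f : (Fin d → ℝ) → ℝ) (hf : MemLp f 2 (volume.restrict (unitCube d))) (j : Fin d) :
    MemLp (fun ω => sampleAverage f (fun i => x i ω)) 2 P ∧
    MemLp (fun ω => sampleAverage (preIntegrate j f) (fun i => x i ω)) 2 P ∧
    variance (fun ω => sampleAverage (preIntegrate j f) (fun i => x i ω)) P ≤
      variance (fun ω => sampleAverage f (fun i => x i ω)) P := by
  rcases hx with ⟨π, ⟨hind, hlaw⟩, hx⟩ | ⟨F, _, e, C, ⟨hind, hlaw⟩, hx⟩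
  · let _ : MeasurableSpace (Equiv.Perm (Fin b)) := ⊤
    have : DiscreteMeasurableSpace (Equiv.Perm (Fin b)) := ⟨fun _ => trivial⟩
    exact variance_sampleAverage_preIntegrate_le_of_blocks (ν := fun _ => uniformOn Set.univ)
      hind hlaw (fun i k => measurePreserving_nestedScramble hb (a i k)) hx hf j
  · let _ : MeasurableSpace F := ⊤
    have : DiscreteMeasurableSpace F := ⟨fun _ => trivial⟩
    have := Finite.of_equiv _ e
    have : ∀ s, IsProbabilityMeasure (uniformOn (affineRange F s)) := fun s => by
      refine isProbabilityMeasure_uniformOn (Set.toFinite _) ⟨1, ?_⟩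
      rcases s with ⟨k, l⟩ | k
      · simp only [affineRange]
        split_ifs <;> simp
      · trivial
    exact variance_sampleAverage_preIntegrate_le_of_blocks
      (ν := fun s => uniformOn (affineRange F s)) hind hlaw
      (fun i k => measurePreserving_affineScramble hb e _ (fun _ => rfl) (a i k)) hx hf j
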